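/- A BCK-algebra is an algebra $(X,*,0)$ of type $(2,0)$ satisfying $((x*y)*(x*z))*(z*y)=0$, $x*0=x$, $0*x=0$, and such that $x*y=0=y*x$ implies $x=y$. A state-morphism BCK-algebra is a pair $(X,\mu)$, regarded as an algebra $(X,*,0,\mu)$ of type $(2,0,1)$, where $(X,*,0)$ is a BCK-algebra, called its BCK-reduct, and $\mu:X\to X$ satisfies $\mu(x*y)=\mu(x)*\mu(y)$ and $\mu(\mu(x))=\mu(x)$ for all $x,y\in X$. For a BCK-algebra $X$, the diagonal state-morphism BCK-algebra $D(X)$ is $(X\times X,\mu_X)$, where $X\times X$ carries the coordinatewise operations and $\mu_X(x,y)=(x,x)$; for a class $\mathcal K$ of BCK-algebras, $\mathsf D(\mathcal K)=\{D(X): X\in\mathcal K\}$. A quasivariety is a class of algebras of the same type that is closed under isomorphic images, subalgebras and reduced products and contains the one-element algebras. A class $\mathcal K$ of algebras of the same type generates the quasivariety $\mathcal V$ if $\mathcal V$ is the least quasivariety containing $\mathcal K$. Theorem. Let $\mathcal K$ be a class of BCK-algebras that generates the quasivariety $\mathcal V$. Then the class $\mathcal V_\mu$ of all state-morphism BCK-algebras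 whose BCK-reduct belongs to $\mathcal V$ is a quasivariety, and it is generated by $\mathsf D(\mathcal K)$. -/

import Mathlib

open CategoryTheory FirstOrder

universe u

/-! ### Quasivarieties of algebras of a given type

An algebraic type (signature) is a first-order language `L` without relation symbols; an algebra of
that type with carrier in `Type u` is a `Bundled.{u} L.Structure`; a class of algebras of that type
is a `Set (Bundled.{u} L.Structure)`. -/

namespace QuasiVar

open FirstOrder.Language FirstOrder.Language.Structure

/-- The coordinatewise operations on `∏ i, A i` respect the relation
`a ~ b ↔ {i | a i = b i} ∈ F`. -/
@[reducible]
def productPrestructure (L : FirstOrder.Language.{0, 0}) [L.IsAlgebraic] {I : Type u} (F : Filter I)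
    (A : I → Bundled.{u} L.Structure) :
    L.Prestructure (F.productSetoid fun i => (A i : Type u)) where
  toStructure :=
    { funMap := fun f x i => funMap f fun k => x k i
      RelMap := fun r _ => isEmptyElim r }
  fun_equiv := by
    intro n f x y hxy
    have h : ∀ᶠ i in F, ∀ k, x k i = y k i := Filter.eventually_all.2 hxy
    exact h.mono fun i hi => congrArg (funMap f) (funext hi)
  rel_equiv := fun {_} {r} _ _ _ => isEmptyElim r

/-- The reduced product `(∏ i, A i) / F` of a family of algebras over a filter `F` on the index
set `I`. -/
def reducedProduct (L : FirstOrder.Language.{0, 0}) [L.IsAlgebraic] {I : Type u} (F : Filter I)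
    (A : I → Bundled.{u} L.Structure) : Bundled.{u} L.Structure where
  α := F.Product fun i => (A i : Type u)
  str := @quotientStructure L _ _ (productPrestructure L F A)

/-- A quasivariety: a class of algebras of the same type that is closed under isomorphic images,
subalgebras and reduced products, and contains the one-element algebras.  (All the types used
below have a constant symbol, so that every algebra and every subalgebra is non-empty.) -/
structure IsQuasivariety (L : FirstOrder.Language.{0, 0}) [L.IsAlgebraic]
    (V : Set (Bundled.{u} L.Structure)) : Prop where
  iso_mem : ∀ A B : Bundled.{u} L.Structure, A ∈ V → Nonempty (A ≃[L] B) → B ∈ V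
  subalgebra_mem : ∀ A : Bundled.{u} L.Structure, A ∈ V →
    ∀ S : L.Substructure A, (⟨S, inferInstance⟩ : Bundled.{u} L.Structure) ∈ V
  reducedProduct_mem : ∀ (I : Type u) (F : Filter I) (A : I → Bundled.{u} L.Structure),
    (∀ i, A i ∈ V) → reducedProduct L F A ∈ V
  one_mem : ∀ A : Bundled.{u} L.Structure, Nonempty A → Subsingleton A → A ∈ V

/-- `K` generates `V` as a quasivariety: `V` is the least quasivariety that contains `K`. -/
def Generates (L : FirstOrder.Language.{0, 0}) [L.IsAlgebraic] (K V : Set (Bundled.{u} L.Structure)) : Prop :=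
  IsLeast {W | IsQuasivariety L W ∧ K ⊆ W} V

end QuasiVar

/-! ### BCK-algebras and state-morphism BCK-algebras -/

namespace BCK

open FirstOrder.Language FirstOrder.Language.Structure

/-- The operation symbols `*`, `0` of BCK-algebras. -/
inductive BCKFunc : ℕ → Type
  | zero : BCKFunc 0
  | star : BCKFunc 2

/-- The algebraic type of BCK-algebras. -/
abbrev bck : FirstOrder.Language.{0, 0} := ⟨BCKFunc, fun _ => Empty⟩

instance : bck.IsAlgebraic := fun _ => inferInstanceAs (IsEmpty Empty)

/-- The operation symbols `*`, `0`, `μ` of state-morphism BCK-algebras. -/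
inductive SMFunc : ℕ → Type
  | zero : SMFunc 0
  | star : SMFunc 2
  | mu : SMFunc 1

/-- The algebraic type of state-morphism BCK-algebras. -/
abbrev smbck : FirstOrder.Language.{0, 0} := ⟨SMFunc, fun _ => Empty⟩

instance : smbck.IsAlgebraic := fun _ => inferInstanceAs (IsEmpty Empty)

/-- The constant `0`. -/
def zero (A : Bundled.{u} bck.Structure) : A :=
  funMap (L := bck) BCKFunc.zero ![]

/-- The operation `x * y`. -/
def op (A : Bundled.{u} bck.Structure) (x y : A) : A :=
  funMap (L := bck) BCKFunc.star ![x, y]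

/-- BCK-algebras. -/
structure IsBCK (A : Bundled.{u} bck.Structure) : Prop where
  bck1 : ∀ x y z : A, op A (op A (op A x y) (op A x z)) (op A z y) = zero A
  bck2 : ∀ x : A, op A x (zero A) = x
  bck3 : ∀ x y : A, op A x y = zero A → op A y x = zero A → y = x
  bck4 : ∀ x : A, op A (zero A) x = zero A

/-- The inclusion of the type of BCK-algebras into that of state-morphism BCK-algebras. -/
def incl : bck →ᴸ smbck where
  onFunction := fun _ f =>
    match f with
    | BCKFunc.zero => SMFunc.zero
    | BCKFunc.star => SMFunc.star
  onRelation := fun _ r => r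

/-- The reduct `(X, *, 0)` of `(X, *, 0, μ)`. -/
abbrev reduct (B : Bundled.{u} smbck.Structure) : Bundled.{u} bck.Structure :=
  ⟨B, incl.reduct B⟩

/-- The unary operation `μ`. -/
def mu (B : Bundled.{u} smbck.Structure) (x : B) : B :=
  funMap (L := smbck) SMFunc.mu ![x]

/-- State-morphism BCK-algebras: a BCK-algebra with an idempotent endomorphism `μ`. -/
structure IsStateMorphismBCK (B : Bundled.{u} smbck.Structure) : Prop where
  isBCK : IsBCK (reduct B)
  mu_star : ∀ x y : B, mu B (op (reduct B) x y) = op (reduct B) (mu B x) (mu B y)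
  mu_mu : ∀ x : B, mu B (mu B x) = mu B x

/-- The diagonal state-morphism algebra `D(X) = (X × X, μ_X)`, with the coordinatewise operations
of `X × X` and `μ_X (x, y) = (x, x)`. -/
def diag (A : Bundled.{u} bck.Structure) : Bundled.{u} smbck.Structure where
  α := A × A
  str :=
    { funMap := fun f =>
        match f with
        | SMFunc.zero => fun _ => (zero A, zero A)
        | SMFunc.star => fun v => (op A (v 0).1 (v 1).1, op A (v 0).2 (v 1).2)
        | SMFunc.mu => fun v => ((v 0).1, (v 0).1)
      RelMap := fun r _ => isEmptyElim r }

/-- The class `D(K)` of the diagonal state-morphism algebras `D(X)`, `X ∈ K`. -/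
def diagClass (K : Set (Bundled.{u} bck.Structure)) : Set (Bundled.{u} smbck.Structure) :=
  diag '' K

/-- The class `V_μ` of the state-morphism BCK-algebras whose BCK-reduct lies in `V`. -/
def muClass (V : Set (Bundled.{u} bck.Structure)) : Set (Bundled.{u} smbck.Structure) :=
  {B | IsStateMorphismBCK B ∧ reduct B ∈ V}

end BCK

/-! Two facts carry the proof. A state-morphism BCK-algebra `B` embeds into `D` of its reduct by `x
↦ (μ x, x)` (`toDiag`), since `μ` is an idempotent endomorphism. And for every quasivariety `W` of
the larger type, the algebras `A` with `D(A) ∈ W` form a quasivariety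
(`isQuasivariety_diag_preimage`), since `D` preserves injective homomorphisms and `D` of a reduced
product embeds into the reduced product of the `D(A i)`. So if `W` contains `D(K)`, leastness of `V`
gives `D(A) ∈ W` for all `A ∈ V`, and each `B` in `V_μ` lies in `W` as a subalgebra of such a
`D(A)`, up to isomorphism. -/

namespace QuasiVar

open FirstOrder.Language FirstOrder.Language.Structure

/-! ### Reduced products and embeddings in any algebraic type -/

variable {L : FirstOrder.Language.{0, 0}} [L.IsAlgebraic]

/-- The class of `a` in the reduced product. -/
def mk {I : Type u} (F : Filter I) (A : I → Bundled.{u} L.Structure) (a : ∀ i, A i) :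
    reducedProduct L F A :=
  Quotient.mk (F.productSetoid fun i => (A i : Type u)) a

theorem mk_surjective {I : Type u} (F : Filter I) (A : I → Bundled.{u} L.Structure) :
    Function.Surjective (mk F A) := Quotient.mk_surjective

theorem mk_eq_mk_iff {I : Type u} {F : Filter I} {A : I → Bundled.{u} L.Structure}
    {a b : ∀ i, A i} : mk F A a = mk F A b ↔ ∀ᶠ i in F, a i = b i :=
  Quotient.eq (r := F.productSetoid fun i => (A i : Type u))

theorem funMap_mk {I : Type u} (F : Filter I) (A : I → Bundled.{u} L.Structure) {n : ℕ}
    (f : L.Functions n) (x : Fin n → ∀ i, A i) :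
    funMap f (fun k => mk F A (x k)) = mk F A fun i => funMap f fun k => x k i :=
  @funMap_quotient_mk' L _ (F.productSetoid fun i => (A i : Type u))
    (productPrestructure L F A) n f x

/-- Without relation symbols an injective homomorphism is an embedding, so its source is isomorphic
to a subalgebra of its target. -/
theorem IsQuasivariety.of_injective {V : Set (Bundled.{u} L.Structure)} (hV : IsQuasivariety L V)
    {A B : Bundled.{u} L.Structure} (hB : B ∈ V) (f : A →[L] B) (hf : Function.Injective f) :
    A ∈ V :=
  hV.iso_mem _ _ (hV.subalgebra_mem B hB (Embedding.ofInjective hf).toHom.range)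
    ⟨(Embedding.ofInjective hf).equivRange.symm⟩

end QuasiVar

namespace BCK

open FirstOrder.Language FirstOrder.Language.Structure QuasiVar

/-! ### Homomorphisms in terms of `0`, `*`, `μ` -/

/-- A map that preserves `0` and `*` is a homomorphism. -/
def homOfOp {A B : Bundled.{u} bck.Structure} (f : A → B) (h0 : f (zero A) = zero B)
    (hs : ∀ x y, f (op A x y) = op B (f x) (f y)) : A →[bck] B where
  toFun := f
  map_fun' := by
    intro n g x
    cases g with
    | zero =>
      rw [Subsingleton.elim x (![]), Subsingleton.elim (f ∘ ![]) (![])]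
      exact h0
    | star =>
      have hx : x = ![x 0, x 1] := by ext i; fin_cases i <;> rfl
      have hy : f ∘ x = ![f (x 0), f (x 1)] := by ext i; fin_cases i <;> rfl
      rw [hy, hx]
      exact hs _ _
  map_rel' := fun r => isEmptyElim r

/-- A map that preserves `0`, `*` and `μ` is a homomorphism. -/
def homOfOpMu {A B : Bundled.{u} smbck.Structure} (f : A → B)
    (h0 : f (zero (reduct A)) = zero (reduct B))
    (hs : ∀ x y, f (op (reduct A) x y) = op (reduct B) (f x) (f y))
    (hm : ∀ x, f (mu A x) = mu B (f x)) : A →[smbck] B where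
  toFun := f
  map_fun' := by
    intro n g x
    cases g with
    | zero =>
      rw [Subsingleton.elim x (![]), Subsingleton.elim (f ∘ ![]) (![])]
      exact h0
    | star =>
      have hx : x = ![x 0, x 1] := by ext i; fin_cases i <;> rfl
      have hy : f ∘ x = ![f (x 0), f (x 1)] := by ext i; fin_cases i <;> rfl
      rw [hy, hx]
      exact hs _ _
    | mu =>
      have hx : x = ![x 0] := by ext i; fin_cases i; rfl
      have hy : f ∘ x = ![f (x 0)] := by ext i; fin_cases i; rfl
      rw [hy, hx]
      exact hm _
  map_rel' := fun r => isEmptyElim r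

theorem hom_zero {A B : Bundled.{u} bck.Structure} (f : A →[bck] B) : f (zero A) = zero B := by
  refine (f.map_fun (BCKFunc.zero : bck.Functions 0) ![]).trans ?_
  rw [Subsingleton.elim (f ∘ ![]) (![])]
  rfl

theorem hom_op {A B : Bundled.{u} bck.Structure} (f : A →[bck] B) (x y : A) :
    f (op A x y) = op B (f x) (f y) := by
  refine (f.map_fun (BCKFunc.star : bck.Functions 2) ![x, y]).trans ?_
  have hy : f ∘ ![x, y] = ![f x, f y] := by ext i; fin_cases i <;> rfl
  rw [hy]
  rfl

theorem hom_mu {A B : Bundled.{u} smbck.Structure} (f : A →[smbck] B) (x : A) :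
    f (mu A x) = mu B (f x) := by
  refine (f.map_fun (SMFunc.mu : smbck.Functions 1) ![x]).trans ?_
  have hy : f ∘ ![x] = ![f x] := by ext i; fin_cases i; rfl
  rw [hy]
  rfl

/-- A homomorphism of state-morphism BCK-algebras, as a homomorphism of the BCK-reducts. -/
def reductHom {A B : Bundled.{u} smbck.Structure} (f : A →[smbck] B) : reduct A →[bck] reduct B where
  toFun := f
  map_fun' := fun g x => f.map_fun (incl.onFunction g) x
  map_rel' := fun r => isEmptyElim r

/-! ### Operations of reduced products on representatives -/

section ReducedProduct

variable {I : Type u} (F : Filter I)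

theorem zero_reducedProduct (A : I → Bundled.{u} bck.Structure) :
    zero (reducedProduct bck F A) = mk F A fun i => zero (A i) := by
  have h := funMap_mk F A (BCKFunc.zero : bck.Functions 0) ![]
  rw [Subsingleton.elim (fun k => mk F A (![] k)) (![])] at h
  refine h.trans (congrArg _ (funext fun i => ?_))
  rw [Subsingleton.elim (fun k => (![] : Fin 0 → ∀ i, A i) k i) (![])]
  rfl

theorem op_mk (A : I → Bundled.{u} bck.Structure) (a b : ∀ i, A i) :
    op (reducedProduct bck F A) (mk F A a) (mk F A b) = mk F A fun i => op (A i) (a i) (b i) := by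
  have h := funMap_mk F A (BCKFunc.star : bck.Functions 2) ![a, b]
  have e : (fun k => mk F A (![a, b] k)) = ![mk F A a, mk F A b] := by
    ext i; fin_cases i <;> rfl
  rw [e] at h
  refine h.trans (congrArg _ (funext fun i => ?_))
  have e' : (fun k => ![a, b] k i) = ![a i, b i] := by ext k; fin_cases k <;> rfl
  rw [e']
  rfl

theorem mu_mk (B : I → Bundled.{u} smbck.Structure) (a : ∀ i, B i) :
    mu (reducedProduct smbck F B) (mk F B a) = mk F B fun i => mu (B i) (a i) := by
  have h := funMap_mk F B (SMFunc.mu : smbck.Functions 1) ![a]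
  have e : (fun k => mk F B (![a] k)) = ![mk F B a] := by
    ext i; fin_cases i; rfl
  rw [e] at h
  refine h.trans (congrArg _ (funext fun i => ?_))
  have e' : (fun k => ![a] k i) = ![a i] := by ext k; fin_cases k; rfl
  rw [e']
  rfl

/-- Reducts commute with reduced products. -/
theorem reduct_reducedProduct (B : I → Bundled.{u} smbck.Structure) :
    reduct (reducedProduct smbck F B) = reducedProduct bck F fun i => reduct (B i) := by
  -- The carriers agree definitionally, so only the structures have to be compared.
  have h : (reduct (reducedProduct smbck F B)).str =
      (reducedProduct bck F fun i => reduct (B i)).str := by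
    ext n f x
    · cases f <;> rfl
    · exact isEmptyElim f
  exact congrArg (fun t : bck.Structure (reducedProduct smbck F B) => Bundled.mk _ t) h

theorem zero_reduct_reducedProduct (B : I → Bundled.{u} smbck.Structure) :
    zero (reduct (reducedProduct smbck F B)) = mk F B fun i => zero (reduct (B i)) :=
  zero_reducedProduct F fun i => reduct (B i)

theorem op_reduct_mk (B : I → Bundled.{u} smbck.Structure) (a b : ∀ i, B i) :
    op (reduct (reducedProduct smbck F B)) (mk F B a) (mk F B b) =
      mk F B fun i => op (reduct (B i)) (a i) (b i) :=
  op_mk F (fun i => reduct (B i)) a b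

end ReducedProduct

/-! ### Closure properties of the classes -/

theorem IsBCK.of_injective {A B : Bundled.{u} bck.Structure} (hB : IsBCK B) (f : A →[bck] B)
    (hf : Function.Injective f) : IsBCK A where
  bck1 x y z := hf (by simpa only [hom_op, hom_zero] using hB.bck1 _ _ _)
  bck2 x := hf (by simpa only [hom_op, hom_zero] using hB.bck2 _)
  bck3 x y hxy hyx := hf <| hB.bck3 _ _ (by rw [← hom_op, hxy, hom_zero])
    (by rw [← hom_op, hyx, hom_zero])
  bck4 x := hf (by simpa only [hom_op, hom_zero] using hB.bck4 _)

/-- Put `y = z = 0` in the first axiom and cancel zeros by `x * 0 = x`. -/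
theorem IsBCK.op_self {A : Bundled.{u} bck.Structure} (hA : IsBCK A) (x : A) :
    op A x x = zero A := by
  simpa only [hA.bck2] using hA.bck1 x (zero A) (zero A)

theorem IsBCK.reducedProduct {I : Type u} (F : Filter I) (A : I → Bundled.{u} bck.Structure)
    (hA : ∀ i, IsBCK (A i)) : IsBCK (reducedProduct bck F A) where
  bck1 x y z := by
    obtain ⟨x, rfl⟩ := mk_surjective F A x
    obtain ⟨y, rfl⟩ := mk_surjective F A y
    obtain ⟨z, rfl⟩ := mk_surjective F A z
    simp only [op_mk, zero_reducedProduct, (hA _).bck1]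
  bck2 x := by
    obtain ⟨x, rfl⟩ := mk_surjective F A x
    simp only [op_mk, zero_reducedProduct, (hA _).bck2]
  bck3 x y hxy hyx := by
    obtain ⟨x, rfl⟩ := mk_surjective F A x
    obtain ⟨y, rfl⟩ := mk_surjective F A y
    rw [op_mk, zero_reducedProduct, mk_eq_mk_iff] at hxy hyx
    rw [mk_eq_mk_iff]
    -- Each premise holds on a set of `F`, so both hold on the intersection.
    filter_upwards [hxy, hyx] with i h h' using (hA i).bck3 _ _ h h'
  bck4 x := by
    obtain ⟨x, rfl⟩ := mk_surjective F A x
    simp only [op_mk, zero_reducedProduct, (hA _).bck4]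

theorem IsBCK.of_subsingleton (A : Bundled.{u} bck.Structure) [Subsingleton A] : IsBCK A where
  bck1 _ _ _ := Subsingleton.elim _ _
  bck2 _ := Subsingleton.elim _ _
  bck3 _ _ _ _ := Subsingleton.elim _ _
  bck4 _ := Subsingleton.elim _ _

theorem isQuasivariety_isBCK : IsQuasivariety bck {A : Bundled.{u} bck.Structure | IsBCK A} where
  iso_mem := fun _ _ hA ⟨e⟩ => hA.of_injective e.symm.toHom e.symm.injective
  subalgebra_mem := fun _ hA S => hA.of_injective S.subtype.toHom S.subtype.injective
  reducedProduct_mem := fun _ F A hA => IsBCK.reducedProduct F A hA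
  one_mem := fun A _ _ => IsBCK.of_subsingleton A

theorem IsStateMorphismBCK.of_injective {A B : Bundled.{u} smbck.Structure}
    (hB : IsStateMorphismBCK B) (f : A →[smbck] B) (hf : Function.Injective f) :
    IsStateMorphismBCK A where
  isBCK := hB.isBCK.of_injective (reductHom f) hf
  mu_star x y := hf <| by
    have hop : ∀ x y : A, f (op (reduct A) x y) = op (reduct B) (f x) (f y) :=
      hom_op (reductHom f)
    rw [hom_mu, hop, hop, hB.mu_star, hom_mu, hom_mu]
  mu_mu x := hf <| by rw [hom_mu, hom_mu, hB.mu_mu]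

theorem IsStateMorphismBCK.reducedProduct {I : Type u} (F : Filter I)
    (B : I → Bundled.{u} smbck.Structure) (hB : ∀ i, IsStateMorphismBCK (B i)) :
    IsStateMorphismBCK (reducedProduct smbck F B) where
  isBCK := by
    rw [reduct_reducedProduct]
    exact IsBCK.reducedProduct F _ fun i => (hB i).isBCK
  mu_star x y := by
    obtain ⟨x, rfl⟩ := mk_surjective F B x
    obtain ⟨y, rfl⟩ := mk_surjective F B y
    simp only [op_reduct_mk, mu_mk, (hB _).mu_star]
  mu_mu x := by
    obtain ⟨x, rfl⟩ := mk_surjective F B x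
    simp only [mu_mk, (hB _).mu_mu]

/-- Apply `μ` to `0 * 0 = 0` and use `x * x = 0` at `x = μ 0`. -/
theorem IsStateMorphismBCK.mu_zero {B : Bundled.{u} smbck.Structure} (hB : IsStateMorphismBCK B) :
    mu B (zero (reduct B)) = zero (reduct B) := by
  have h := hB.mu_star (zero (reduct B)) (zero (reduct B))
  rwa [hB.isBCK.op_self, hB.isBCK.op_self] at h

theorem isQuasivariety_muClass {V : Set (Bundled.{u} bck.Structure)} (hV : IsQuasivariety bck V)
    (hBCK : ∀ A ∈ V, IsBCK A) : IsQuasivariety smbck (muClass V) where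
  iso_mem := fun _ _ hA ⟨e⟩ => ⟨hA.1.of_injective e.symm.toHom e.symm.injective,
    hV.of_injective hA.2 (reductHom e.symm.toHom) e.symm.injective⟩
  subalgebra_mem := fun _ hA S => ⟨hA.1.of_injective S.subtype.toHom S.subtype.injective,
    hV.of_injective hA.2 (reductHom S.subtype.toHom) S.subtype.injective⟩
  reducedProduct_mem := fun I F A hA => ⟨IsStateMorphismBCK.reducedProduct F A fun i => (hA i).1, by
    rw [reduct_reducedProduct]
    exact hV.reducedProduct_mem I F _ fun i => (hA i).2⟩
  one_mem := fun A hn hs =>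
    have hA : reduct A ∈ V := hV.one_mem (reduct A) hn hs
    ⟨⟨hBCK _ hA, fun _ _ => hs.elim _ _, fun _ => hs.elim _ _⟩, hA⟩

/-! ### The diagonal construction -/

section Diag

theorem zero_diag (A : Bundled.{u} bck.Structure) :
    zero (reduct (diag A)) = ((zero A, zero A) : A × A) := rfl

theorem op_diag (A : Bundled.{u} bck.Structure) (x y : A × A) :
    op (reduct (diag A)) x y = ((op A x.1 y.1, op A x.2 y.2) : A × A) := rfl

theorem mu_diag (A : Bundled.{u} bck.Structure) (x : A × A) :
    mu (diag A) x = ((x.1, x.1) : A × A) := rfl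

/-- The reduct of `D(A)` embeds into a square of `A`. -/
theorem reduct_diag_mem {V : Set (Bundled.{u} bck.Structure)} (hV : IsQuasivariety bck V)
    {A : Bundled.{u} bck.Structure} (hA : A ∈ V) : reduct (diag A) ∈ V := by
  -- The filter `⊤` contains only the whole index set, so its reduced product is the direct power;
  -- `ULift` puts the two indices in `Type u`.
  let C : ULift.{u} Bool → Bundled.{u} bck.Structure := fun _ => A
  let g : A × A → ∀ i, C i := fun x i => if i.down then x.1 else x.2
  refine hV.of_injective (hV.reducedProduct_mem _ ⊤ C fun _ => hA)
    (homOfOp (A := reduct (diag A)) (fun x => mk ⊤ C (g x)) ?_ fun x y => ?_) fun x y h => ?_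
  · rw [zero_reducedProduct]
    refine congrArg _ (funext fun i => ?_)
    exact ite_self _
  · rw [op_mk]
    refine congrArg _ (funext fun ⟨i⟩ => ?_)
    cases i <;> rfl
  · have h' := Filter.eventually_top.1 (mk_eq_mk_iff.1 h)
    exact Prod.ext (h' ⟨true⟩) (h' ⟨false⟩)

theorem isStateMorphismBCK_diag {A : Bundled.{u} bck.Structure} (hA : IsBCK A) :
    IsStateMorphismBCK (diag A) where
  -- The case where `V` is the quasivariety of all BCK-algebras.
  isBCK := reduct_diag_mem isQuasivariety_isBCK hA
  mu_star _ _ := rfl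
  mu_mu _ := rfl

/-- `D` on homomorphisms. -/
def diagHom {A B : Bundled.{u} bck.Structure} (f : A →[bck] B) : diag A →[smbck] diag B :=
  homOfOpMu (A := diag A) (B := diag B) (Prod.map f f)
    (Prod.ext (hom_zero f) (hom_zero f))
    (fun _ _ => Prod.ext (hom_op f _ _) (hom_op f _ _)) fun _ => rfl

theorem diagHom_injective {A B : Bundled.{u} bck.Structure} (f : A →[bck] B)
    (hf : Function.Injective f) : Function.Injective (diagHom f) :=
  hf.prodMap hf

/-- `D` of a reduced product embeds into the reduced product of the `D(A i)`. -/
theorem diag_reducedProduct_mem {W : Set (Bundled.{u} smbck.Structure)}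
    (hW : IsQuasivariety smbck W) {I : Type u} (F : Filter I)
    (A : I → Bundled.{u} bck.Structure) (hA : ∀ i, diag (A i) ∈ W) :
    diag (reducedProduct bck F A) ∈ W := by
  -- Pair representatives; the class is independent of their choice because `F` is closed under
  -- binary intersections.
  let g : reducedProduct bck F A × reducedProduct bck F A →
      reducedProduct smbck F fun i => diag (A i) := fun p =>
    Quotient.map₂ (fun a b i => ((a i, b i) : A i × A i))
      (fun _ _ h _ _ h' => by
        filter_upwards [h, h'] with i hi hi' using Prod.ext hi hi') p.1 p.2
  have hg (a b : ∀ i, A i) : g (mk F A a, mk F A b) =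
      mk F (fun i => diag (A i)) fun i => ((a i, b i) : A i × A i) := rfl
  refine hW.of_injective (hW.reducedProduct_mem I F _ hA)
    (homOfOpMu (A := diag (reducedProduct bck F A)) g ?_ ?_ ?_) ?_
  · rw [zero_diag, zero_reducedProduct, hg, zero_reduct_reducedProduct]
    rfl
  · rintro ⟨x, x'⟩ ⟨y, y'⟩
    obtain ⟨x, rfl⟩ := mk_surjective F A x
    obtain ⟨x', rfl⟩ := mk_surjective F A x'
    obtain ⟨y, rfl⟩ := mk_surjective F A y
    obtain ⟨y', rfl⟩ := mk_surjective F A y'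
    rw [op_diag, op_mk, op_mk, hg, hg, hg]
    exact (op_reduct_mk F (fun i => diag (A i)) (fun i => ((x i, x' i) : A i × A i))
      fun i => ((y i, y' i) : A i × A i)).symm
  · rintro ⟨x, x'⟩
    obtain ⟨x, rfl⟩ := mk_surjective F A x
    obtain ⟨x', rfl⟩ := mk_surjective F A x'
    rw [mu_diag, hg, hg]
    exact (mu_mk F (fun i => diag (A i)) fun i => ((x i, x' i) : A i × A i)).symm
  · rintro ⟨x, x'⟩ ⟨y, y'⟩ h
    obtain ⟨x, rfl⟩ := mk_surjective F A x
    obtain ⟨x', rfl⟩ := mk_surjective F A x'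
    obtain ⟨y, rfl⟩ := mk_surjective F A y
    obtain ⟨y', rfl⟩ := mk_surjective F A y'
    have h' := mk_eq_mk_iff.1 ((hg x x').symm.trans (h.trans (hg y y')))
    exact Prod.ext (mk_eq_mk_iff.2 (h'.mono fun i hi => congrArg Prod.fst hi))
      (mk_eq_mk_iff.2 (h'.mono fun i hi => congrArg Prod.snd hi))

theorem isQuasivariety_diag_preimage {W : Set (Bundled.{u} smbck.Structure)}
    (hW : IsQuasivariety smbck W) : IsQuasivariety bck (diag ⁻¹' W) where
  iso_mem := fun _ _ hA ⟨e⟩ =>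
    hW.of_injective hA (diagHom e.symm.toHom) (diagHom_injective _ e.symm.injective)
  subalgebra_mem := fun _ hA S =>
    hW.of_injective hA (diagHom S.subtype.toHom) (diagHom_injective _ S.subtype.injective)
  reducedProduct_mem := fun _ F A hA => diag_reducedProduct_mem hW F A hA
  one_mem := fun A ⟨a⟩ hs => hW.one_mem (diag A) ⟨((a, a) : A × A)⟩
    ⟨fun _ _ => Prod.ext (hs.elim _ _) (hs.elim _ _)⟩

/-- A state-morphism BCK-algebra `B` embeds into `D` of its reduct by `x ↦ (μ x, x)`. -/
def toDiag {B : Bundled.{u} smbck.Structure} (hB : IsStateMorphismBCK B) :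
    B →[smbck] diag (reduct B) :=
  homOfOpMu (B := diag (reduct B)) (fun x => ((mu B x, x) : B × B))
    (Prod.ext hB.mu_zero rfl) (fun _ _ => Prod.ext (hB.mu_star _ _) rfl)
    -- Idempotence makes `μ x` go to `(μ x, μ x)`, the diagonal image of `(μ x, x)`.
    fun _ => Prod.ext (hB.mu_mu _) rfl

theorem toDiag_injective {B : Bundled.{u} smbck.Structure} (hB : IsStateMorphismBCK B) :
    Function.Injective (toDiag hB) :=
  fun _ _ h => congrArg Prod.snd h

end Diag

end BCK

theorem theorem5 (K V : Set (Bundled.{u} BCK.bck.Structure))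
    (hK : ∀ A ∈ K, BCK.IsBCK A) (hV : QuasiVar.Generates BCK.bck K V) :
    QuasiVar.Generates BCK.smbck (BCK.diagClass K) (BCK.muClass V) := by
  obtain ⟨⟨hVq, hKV⟩, hleast⟩ := hV
  -- The BCK-algebras form a quasivariety containing `K`, so leastness applies.
  have hBCK : ∀ A ∈ V, BCK.IsBCK A := hleast ⟨BCK.isQuasivariety_isBCK, hK⟩
  refine ⟨⟨BCK.isQuasivariety_muClass hVq hBCK, ?_⟩, ?_⟩
  · rintro _ ⟨A, hA, rfl⟩
    exact ⟨BCK.isStateMorphismBCK_diag (hK A hA), BCK.reduct_diag_mem hVq (hKV hA)⟩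
  · rintro W ⟨hW, hDW⟩ B ⟨hB, hBV⟩
    have hVW : V ⊆ BCK.diag ⁻¹' W :=
      hleast ⟨BCK.isQuasivariety_diag_preimage hW, fun A hA => hDW ⟨A, hA, rfl⟩⟩
    exact hW.of_injective (hVW hBV) (BCK.toDiag hB) (BCK.toDiag_injective hB)
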